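/- For $N\ge 0$ and $m\ge 0$ let $b_{N,m}$ be the number of pairs $(u,s)$, where $u=u_1u_2\cdots u_{2N}$ is a Dyck path of length $2N$ (from $(0,0)$ to $(2N,0)$, with northeast steps $(1,1)$ and southeast steps $(1,-1)$, never going below the line $y=0$) and $s=(s_1,\dots,s_{2N})$ is a sequence of integers with $s_1+\cdots+s_{2N}=m$ such that $0\le s_i\le j$ whenever $u_i$ is a northeast step starting at height $j$, and $0\le s_i\le k-1$ whenever $u_i$ is a southeast step starting at height $k$. Let $$G'(t,q)=\sum_{N,m\ge 0} b_{N,m}\,t^{2N}q^m ,$$ regarded as a formal power series in $t$ whose coefficients are polynomials in $q$ (the coefficient of $t^{2N}$ is the $N$-th $q$-secant number). Then for every $N\ge 0$, $$[t^{2N}]\,G'(t,q)=\frac{1}{(1-q)^{2N}}\sum_{m=0}^{N}\frac{q^{m^2+m}\left(\sum_{l=-m}^{m}(-1)^l q^{-l^2}\right)(2m+1)\binom{2N}{N+m}}{N+m+1},$$ where $q$ is an indeterminate or, more generally, any element with $q\ne 0,1$ of a field of characteristic $0$. -/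

import Mathlib

/-- The height of the starting point of the `i`-th step of a Dyck path: the number of northeast
steps minus the number of southeast steps among the first `i` steps
(never negative for a Dyck path). -/
def DyckWord.startHeight (u : DyckWord) (i : ℕ) : ℕ :=
  (u.toList.take i).count DyckStep.U - (u.toList.take i).count DyckStep.D

/-- A path diagram for a possibility function `pos`, where `pos DyckStep.U j` is the value at `a_j`
(a northeast step starting at height `j`) and `pos DyckStep.D k` is the value at `b_k`
(a southeast step starting at height `k`). It is a Dyck path `u₁ u₂ … uₙ` together with
a sequence of integers `s₁ s₂ … sₙ` such that `0 ≤ sᵢ ≤ pos uᵢ`. -/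
@[ext]
structure PathDiagram (pos : DyckStep → ℕ → ℕ) where
  /-- the Dyck path -/
  path : DyckWord
  /-- the column heights -/
  col : Fin path.toList.length → ℕ
  /-- the column heights respect the possibility function -/
  col_le : ∀ i, col i ≤ pos (path.toList.get i) (path.startHeight i)

/-- The sum of the column heights of a path diagram. -/
def PathDiagram.colSum {pos : DyckStep → ℕ → ℕ} (d : PathDiagram pos) : ℕ :=
  ∑ i, d.col i

/-- The possibility function `pos a_j = j`, `pos b_k = k - 1`. A southeast step always starts at
a height `k ≥ 1`, so that the subtraction is never truncated on a Dyck path. -/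
def secantPos : DyckStep → ℕ → ℕ
  | DyckStep.U, j => j
  | DyckStep.D, k => k - 1

/-- `b_{N,m}`: the number of path diagrams for `secantPos` whose Dyck path has length `2N`
(any height) and whose column heights sum up to `m`. -/
noncomputable def secantCount (N m : ℕ) : ℕ :=
  Nat.card {d : PathDiagram secantPos // d.path.semilength = N ∧ d.colSum = m}

/-- There are only finitely many path diagrams of a given length. -/
theorem PathDiagram.finite_semilength (pos : DyckStep → ℕ → ℕ) (N : ℕ) :
    Finite {d : PathDiagram pos // d.path.semilength = N} := by
  let T := Σ p : {p : DyckWord // p.semilength = N},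
    ∀ i : Fin p.1.toList.length, Fin (pos (p.1.toList.get i) (p.1.startHeight i) + 1)
  let f : T → {d : PathDiagram pos // d.path.semilength = N} := fun x =>
    ⟨⟨x.1.1, fun i => (x.2 i : ℕ), fun i => Nat.lt_succ_iff.mp (x.2 i).2⟩, x.1.2⟩
  apply Finite.of_surjective f
  rintro ⟨⟨p, c, hc⟩, hp⟩
  exact ⟨⟨⟨p, hp⟩, fun i => ⟨c i, Nat.lt_succ_of_le (hc i)⟩⟩, rfl⟩

/-- For each `N` only finitely many of the numbers `b_{N,m}` are nonzero, hence
`∑_m b_{N,m} q^m` is a finite sum. -/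
theorem secantCount_finite_support (N : ℕ) : {m : ℕ | secantCount N m ≠ 0}.Finite := by
  have := PathDiagram.finite_semilength secantPos N
  refine (Set.finite_range
    (fun d : {d : PathDiagram secantPos // d.path.semilength = N} => d.1.colSum)).subset ?_
  intro m hm
  obtain ⟨⟨d, hd, hs⟩⟩ := (Nat.card_ne_zero.mp hm).1
  exact ⟨⟨d, hd⟩, hs⟩

/-- The generating function `G'(t,q) = ∑_{N,m} b_{N,m} t^{2N} q^m` as a formal power series
in `t`; its coefficients are finite sums by `secantCount_finite_support`. -/
noncomputable def secantGF {K : Type*} [Field K] (q : K) : PowerSeries K :=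
  PowerSeries.mk fun n =>
    if Even n then ∑ᶠ m : ℕ, (secantCount (n / 2) m : K) * q ^ m else 0

/-!
The `N`-th coefficient is the weighted number of Dyck paths of length `2N` in which an up step from
height `j` has weight `[j+1] = 1 + q + ⋯ + q^j` and a down step from height `k` has weight `[k]`.
Up to the factor `(1-q)^(2N)` it is the moment of order `2N` of the linear functional `L` on `K[X]`
for which the polynomials `pₙ₊₁ = X pₙ - (1-qⁿ)² pₙ₋₁` are orthogonal
(`moment_X_pow_mul_orthoPoly`). These are Al-Salam–Chihara polynomials, and they are compared with
the continuous `q`-Hermite polynomials `Hₙ₊₁ = X Hₙ - (1-qⁿ) Hₙ₋₁`: the values `L(Hₙ pₕ)` have a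
product form (`moment_qHermite_mul_orthoPoly`), whence `L(Hₙ) = wₙ` with
`wₙ₊₂ = -q (1-qⁿ⁺¹) wₙ`.

The monomials are expanded in the rescaled Chebyshev polynomials
`Sⱼ(z + z⁻¹) = zʲ + zʲ⁻² + ⋯ + z⁻ʲ`, and the coefficients are the ballot numbers
`C(2N, N+m) - C(2N, N+m+1) = (2m+1) C(2N, N+m) / (N+m+1)`. It remains to find `L(S₂ₘ)`.
The weight function of `L`, divided by `1 - z⁻²`, is a quotient of theta functions, hence
quasi-periodic under `z ↦ qz`, and crossing its pole `z² = -q` produces an additional residue term.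
The algebraic shadow of this fact is the linear relation `mixedMoment_shift` among the numbers
`L(Sᵢ₋₁ Hₙ)`, in which `z ↦ qz` acts on `Hₙ` by
`qⁿ Hₙ(qz) = z² Hₙ₊₂(z) - (1+q) z³ Hₙ₊₁(z) + q z⁴ Hₙ(z)` for `Hₙ` viewed as a Laurent polynomial
in `z`. The relation propagates by the common three-term recurrence in `i` and `n` from the values
at `i = 0, 1`, which are known. At `n = 0` it becomes
`L(S₂ₘ₊₂) = q^(2m+2) L(S₂ₘ) + 2 (-q)^(m+1)`, which is solved by
`q^(m²+m) ∑_{|l| ≤ m} (-1)^l q^(-l²)`. All the relations are free of divisions by `1 - qⁿ`, so that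
roots of unity need no separate treatment.
-/

/-! ### Path diagrams and weighted paths -/

section Combinatorics

open DyckStep

/-- The steps of `l` form a path from height `h` to height `0` that never goes below height `0`. -/
def IsDescent (h : ℕ) (l : List DyckStep) : Prop :=
  h + l.count U = l.count D ∧ ∀ i, (l.take i).count D ≤ h + (l.take i).count U

theorem isDescent_U_cons (h : ℕ) (l : List DyckStep) :
    IsDescent h (U :: l) ↔ IsDescent (h + 1) l := by
  unfold IsDescent
  refine and_congr (by simp; omega) ⟨fun H i => ?_, fun H i => ?_⟩
  · have := H (i + 1)
    simp at this
    omega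
  · cases i with
    | zero => simp
    | succ i =>
      have := H i
      simp
      omega

theorem isDescent_D_cons (h : ℕ) (l : List DyckStep) :
    IsDescent h (D :: l) ↔ h ≠ 0 ∧ IsDescent (h - 1) l := by
  unfold IsDescent
  constructor
  · rintro ⟨H, H'⟩
    have h0 := H' 1
    simp at h0 H
    refine ⟨by omega, by omega, fun i => ?_⟩
    have := H' (i + 1)
    simp at this
    omega
  · rintro ⟨h0, H, H'⟩
    refine ⟨by simp; omega, fun i => ?_⟩
    cases i with
    | zero => simp
    | succ i =>
      have := H' i
      simp
      omega

/-- The finite set of the paths of length `n` from height `h` to height `0` that never go below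
height `0`, built by the choice of the first step. -/
def descents : ℕ → ℕ → Finset (List DyckStep)
  | 0, 0 => {[]}
  | 0, _ + 1 => ∅
  | n + 1, 0 => (descents n 1).map ⟨List.cons U, List.cons_injective⟩
  | n + 1, h + 1 => ((descents n (h + 2)).map ⟨List.cons U, List.cons_injective⟩).disjUnion
      ((descents n h).map ⟨List.cons D, List.cons_injective⟩)
      (by simp [Finset.disjoint_left])

theorem mem_descents (n : ℕ) : ∀ (h : ℕ) (l : List DyckStep),
    l ∈ descents n h ↔ l.length = n ∧ IsDescent h l := by
  induction n with
  | zero =>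
    rintro (_ | h) l <;> cases l <;> simp [descents, IsDescent]
  | succ n ih =>
    intro h l
    match l with
    | [] => cases h <;> simp [descents]
    | U :: l => cases h <;> simp [descents, ih, isDescent_U_cons]
    | D :: l => cases h <;> simp [descents, ih, isDescent_D_cons]

variable {K : Type*} [Field K]

/-- The generating polynomial, evaluated at `q`, of the sequences of column heights that
`secantPos` allows on the path with steps `l` that starts at height `h`. -/
def pathWeight (q : K) (h : ℕ) (l : List DyckStep) : K :=
  ∏ i : Fin l.length, ∑ s ∈ Finset.range
    (secantPos (l.get i) (h + (l.take i).count U - (l.take i).count D) + 1), q ^ s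

theorem pathWeight_U_cons (q : K) (h : ℕ) (l : List DyckStep) :
    pathWeight q h (U :: l) = (∑ s ∈ Finset.range (h + 1), q ^ s) * pathWeight q (h + 1) l := by
  simp only [pathWeight]
  refine (Fin.prod_univ_succ _).trans ?_
  congr 1
  refine Finset.prod_congr rfl fun i _ => ?_
  simp [Nat.add_right_comm h 1, add_assoc]

theorem pathWeight_D_cons (q : K) (h : ℕ) (l : List DyckStep) :
    pathWeight q (h + 1) (D :: l) =
      (∑ s ∈ Finset.range (h + 1), q ^ s) * pathWeight q h l := by
  simp only [pathWeight]
  refine (Fin.prod_univ_succ _).trans ?_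
  congr 1
  refine Finset.prod_congr rfl fun i _ => ?_
  simp [add_right_comm]

/-- The total weight of the paths of length `n` from height `h` to height `0`, where an up step
from height `j` has weight `[j+1]` and a down step from height `k` has weight `[k]`. -/
def pathSum (q : K) : ℕ → ℕ → K
  | 0, 0 => 1
  | 0, _ + 1 => 0
  | n + 1, 0 => (∑ i ∈ Finset.range 1, q ^ i) * pathSum q n 1
  | n + 1, h + 1 => (∑ i ∈ Finset.range (h + 2), q ^ i) * pathSum q n (h + 2) +
      (∑ i ∈ Finset.range (h + 1), q ^ i) * pathSum q n h

theorem sum_pathWeight (q : K) (n : ℕ) : ∀ h : ℕ,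
    ∑ l ∈ descents n h, pathWeight q h l = pathSum q n h := by
  induction n with
  | zero => rintro (_ | h) <;> simp [descents, pathSum, pathWeight]
  | succ n ih =>
    rintro (_ | h)
    · simp [descents, pathSum, pathWeight_U_cons, ih]
    · rw [descents, Finset.sum_disjUnion, Finset.sum_map, Finset.sum_map]
      simp only [Function.Embedding.coeFn_mk, pathWeight_U_cons, pathWeight_D_cons,
        ← Finset.mul_sum, ih, pathSum]

/-- The `N`-th `q`-secant number as a weighted sum over Dyck paths. -/
theorem sum_secantCount (q : K) (N : ℕ) :
    ∑ᶠ m : ℕ, (secantCount N m : K) * q ^ m = pathSum q (2 * N) 0 := by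
  classical
  have := PathDiagram.finite_semilength secantPos N
  have := Fintype.ofFinite {d : PathDiagram secantPos // d.path.semilength = N}
  have hfib : ∀ m, (secantCount N m : K) = ∑ d : {d : PathDiagram secantPos //
      d.path.semilength = N}, if d.1.colSum = m then 1 else 0 := by
    intro m
    rw [Finset.sum_boole, secantCount, ← Fintype.card_subtype, ← Nat.card_eq_fintype_card]
    exact congrArg _ (Nat.card_congr (Equiv.subtypeSubtypeEquivSubtypeInter _ _).symm)
  have hsum : ∑ᶠ m : ℕ, (secantCount N m : K) * q ^ m =
      ∑ d : {d : PathDiagram secantPos // d.path.semilength = N}, q ^ d.1.colSum := by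
    rw [finsum_eq_sum_of_support_subset (s := Finset.univ.image
      fun d : {d : PathDiagram secantPos // d.path.semilength = N} => d.1.colSum)]
    · simp only [hfib, Finset.sum_mul]
      rw [Finset.sum_comm]
      refine Finset.sum_congr rfl fun d _ => ?_
      simp
    · intro m hm
      have hm : secantCount N m ≠ 0 := fun h => hm (by simp [h])
      obtain ⟨⟨d, hd, hs⟩⟩ := (Nat.card_ne_zero.mp hm).1
      simpa using ⟨d, hd, hs⟩
  rw [hsum, ← sum_pathWeight]
  simp only [pathWeight, Finset.prod_univ_sum]
  rw [Finset.sum_sigma']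
  have mem : ∀ x : (Σ l : List DyckStep, Fin l.length → ℕ),
      x ∈ (descents (2 * N) 0).sigma (fun l => Fintype.piFinset fun i : Fin l.length =>
        Finset.range (secantPos (l.get i) (0 + (l.take i).count U - (l.take i).count D) + 1)) ↔
      (x.1.length = 2 * N ∧ IsDescent 0 x.1) ∧ ∀ i, x.2 i ≤
        secantPos (x.1.get i) ((x.1.take i).count U - (x.1.take i).count D) := by
    intro x
    simp only [Finset.mem_sigma, mem_descents, Fintype.mem_piFinset, Finset.mem_range,
      Nat.lt_succ_iff, zero_add]
  have len : ∀ l : List DyckStep, l.length = l.count U + l.count D := fun l => by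
    induction l with
    | nil => rfl
    | cons a l ih => cases a <;> simp [ih] <;> omega
  refine Finset.sum_bij (fun d _ => ⟨d.1.path.toList, d.1.col⟩) ?_ ?_ ?_ ?_
  · rintro ⟨d, rfl⟩ -
    refine (mem _).2 ⟨⟨?_, ?_, ?_⟩, d.col_le⟩
    · exact d.path.two_mul_semilength_eq_length.symm
    · simpa using d.path.count_U_eq_count_D
    · simpa using d.path.count_D_le_count_U
  · rintro ⟨⟨⟨l, hl, hl'⟩, c, hc⟩, hd⟩ - ⟨⟨⟨k, hk, hk'⟩, c', hc'⟩, hd'⟩ - H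
    obtain ⟨rfl, H⟩ := Sigma.mk.inj_iff.1 H
    obtain rfl := eq_of_heq H
    rfl
  · rintro ⟨l, c⟩ hx
    obtain ⟨⟨hlen, hl, hl'⟩, hc⟩ := (mem _).1 hx
    simp only [zero_add] at hl hl' hlen
    refine ⟨⟨⟨⟨l, hl, hl'⟩, c, hc⟩, ?_⟩, Finset.mem_univ _, rfl⟩
    have := len l
    change l.count U = N
    omega
  · intro d _
    exact (Finset.prod_pow_eq_pow_sum _ _ _).symm

end Combinatorics

section Moments

open Polynomial

variable {K : Type*} [Field K]

/-! ### The moment functional and its orthogonal polynomials -/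

/-- The linear functional on `K[X]` whose moments are the numbers `(1-q)^n * pathSum q n 0`. -/
noncomputable def moment (q : K) : K[X] →ₗ[K] K :=
  Polynomial.lsum fun n => LinearMap.toSpanSingleton K K ((1 - q) ^ n * pathSum q n 0)

theorem moment_X_pow (q : K) (n : ℕ) : moment q (X ^ n) = (1 - q) ^ n * pathSum q n 0 := by
  simp [moment, ← Polynomial.monomial_one_right_eq_X_pow]

theorem moment_C_mul (q c : K) (p : K[X]) : moment q (C c * p) = c * moment q p := by
  rw [← Polynomial.smul_eq_C_mul, map_smul, smul_eq_mul]

/-- The monic polynomials `pₙ₊₁ = X pₙ - (1-qⁿ)² pₙ₋₁`, which are orthogonal for `moment q`. -/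
noncomputable def orthoPoly (q : K) : ℕ → K[X]
  | 0 => 1
  | 1 => X
  | h + 2 => X * orthoPoly q (h + 1) - C ((1 - q ^ (h + 1)) ^ 2) * orthoPoly q h

/-- The monic continuous `q`-Hermite polynomials `Hₙ₊₁ = X Hₙ - (1-qⁿ) Hₙ₋₁`, scaled so that
`X = z + z⁻¹`. -/
noncomputable def qHermite (q : K) : ℕ → K[X]
  | 0 => 1
  | 1 => X
  | n + 2 => X * qHermite q (n + 1) - C (1 - q ^ (n + 1)) * qHermite q n

/-- The `q`-shifted factorial `(q^(r+1); q)_h = (1-q^(r+1)) ⋯ (1-q^(r+h))`. -/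
def qFac (q : K) (r h : ℕ) : K := ∏ i ∈ Finset.range h, (1 - q ^ (r + i + 1))

/-- Multiplication by `X` acts on `pₕ` as prolonging a path by one step acts on its weight, up to
the factor `qFac q 0 h`, which turns the weights `(1-q^(h+1)), (1-q^h)` of the two steps into
`1, (1-q^h)²`. -/
theorem moment_X_pow_mul_orthoPoly (q : K) (h : ℕ) : ∀ n : ℕ,
    moment q (X ^ n * orthoPoly q h) = qFac q 0 h * ((1 - q) ^ n * pathSum q n h) := by
  have e : ∀ k : ℕ, (1 - q) * ∑ i ∈ Finset.range k, q ^ i = 1 - q ^ k := mul_neg_geom_sum q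
  induction h using Nat.strong_induction_on with
  | _ h ih =>
    intro n
    match h, ih with
    | 0, _ => simp [orthoPoly, qFac, moment_X_pow]
    | 1, _ =>
      have : X ^ n * orthoPoly q 1 = X ^ (n + 1) := by simp [orthoPoly, pow_succ]
      rw [this, moment_X_pow]
      simp [qFac, pathSum]; ring
    | h + 2, ih =>
      have : X ^ n * orthoPoly q (h + 2) = X ^ (n + 1) * orthoPoly q (h + 1) -
          C ((1 - q ^ (h + 1)) ^ 2) * (X ^ n * orthoPoly q h) := by
        rw [orthoPoly]; ring
      rw [this, map_sub, moment_C_mul, ih (h + 1) (by omega), ih h (by omega), pathSum]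
      have e1 := e (h + 1)
      have e2 := e (h + 2)
      simp only [qFac, Finset.prod_range_succ, zero_add]
      rw [show h + 1 + 1 = h + 2 from rfl, ← e1, ← e2]
      ring

theorem moment_orthoPoly_succ (q : K) (h : ℕ) : moment q (orthoPoly q (h + 1)) = 0 := by
  have := moment_X_pow_mul_orthoPoly q (h + 1) 0
  simpa [pathSum] using this

/-! ### Moments of the `q`-Hermite polynomials -/

/-- The numbers `w₂ₖ = (-q)ᵏ (1-q)(1-q³)⋯(1-q²ᵏ⁻¹)`, `w₂ₖ₊₁ = 0`, which are the values of
`moment q` on the `q`-Hermite polynomials. -/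
def hermiteMoment (q : K) : ℕ → K
  | 0 => 1
  | 1 => 0
  | n + 2 => -q * (1 - q ^ (n + 1)) * hermiteMoment q n

/-- For `h = 0` the truncated index `h - 1` is harmless, as its coefficient vanishes. -/
theorem X_mul_orthoPoly (q : K) (h : ℕ) :
    X * orthoPoly q h = orthoPoly q (h + 1) + C ((1 - q ^ h) ^ 2) * orthoPoly q (h - 1) := by
  cases h <;> simp [orthoPoly]

theorem X_mul_qHermite (q : K) (n : ℕ) :
    X * qHermite q n = qHermite q (n + 1) + C (1 - q ^ n) * qHermite q (n - 1) := by
  cases n <;> simp [qHermite]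

theorem qFac_succ (q : K) (r h : ℕ) : qFac q r (h + 1) = qFac q r h * (1 - q ^ (r + h + 1)) :=
  Finset.prod_range_succ _ _

theorem qFac_succ_left (q : K) (r h : ℕ) :
    qFac q r (h + 1) = (1 - q ^ (r + 1)) * qFac q (r + 1) h := by
  rw [qFac, qFac, Finset.prod_range_succ', mul_comm]
  simp only [add_zero]
  congr 1
  exact Finset.prod_congr rfl fun i _ => by ring_nf

/-- The coefficients of the expansion of `Hₙ` in the `pₕ`, up to the squared norm of `pₕ`. Both
sides satisfy the recurrence obtained by computing `X Hₙ pₕ` in two ways. -/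
theorem moment_qHermite_mul_orthoPoly (q : K) (n : ℕ) :
    (∀ h, n < h → moment q (qHermite q n * orthoPoly q h) = 0) ∧
    ∀ r h, r + h = n → moment q (qHermite q n * orthoPoly q h) =
      qFac q 0 h * qFac q r h * hermiteMoment q r := by
  have step : ∀ n h : ℕ, moment q (qHermite q (n + 1) * orthoPoly q h) =
      moment q (qHermite q n * orthoPoly q (h + 1)) +
      (1 - q ^ h) ^ 2 * moment q (qHermite q n * orthoPoly q (h - 1)) -
      (1 - q ^ n) * moment q (qHermite q (n - 1) * orthoPoly q h) := by
    intro n h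
    rw [← moment_C_mul, ← moment_C_mul, ← map_add, ← map_sub]
    congr 1
    linear_combination orthoPoly q h * (-X_mul_qHermite q n) + qHermite q n * X_mul_orthoPoly q h
  induction n using Nat.strong_induction_on with
  | _ n ih =>
    match n, ih with
    | 0, _ =>
      constructor
      · intro h hh
        obtain ⟨k, rfl⟩ := Nat.exists_eq_succ_of_ne_zero hh.ne'
        simp [qHermite, moment_orthoPoly_succ]
      · intro r h hr
        obtain ⟨rfl, rfl⟩ : r = 0 ∧ h = 0 := by omega
        have := moment_X_pow q 0
        simp [qHermite, orthoPoly, qFac, hermiteMoment, pathSum] at this ⊢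
        exact this
    | n + 1, ih =>
      have zero := fun k (hk : k < n + 1) => (ih k hk).1
      have val := fun k (hk : k < n + 1) => (ih k hk).2
      have prev : ∀ h, n ≤ h → (1 - q ^ n) * moment q (qHermite q (n - 1) * orthoPoly q h) = 0 := by
        intro h hh
        rcases Nat.eq_zero_or_pos n with rfl | hn
        · simp
        · rw [zero _ (by omega) _ (by omega), mul_zero]
      constructor
      · intro h hh
        rw [step, zero n (by omega) _ (by omega), zero n (by omega) _ (by omega),
          prev _ (by omega)]
        ring
      · intro r h hr
        rw [step]
        match r, h, hr with
        | 0, h + 1, hr =>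
          obtain rfl : h = n := by omega
          rw [zero _ (by omega) _ (by omega), prev _ (by omega), Nat.add_sub_cancel,
            val h (by omega) 0 h (by omega), qFac_succ]
          simp only [zero_add]; ring
        | 1, 0, hr =>
          obtain rfl : n = 0 := by omega
          rw [zero _ (by omega) _ (by omega)]
          simp [hermiteMoment]
        | r + 2, 0, hr =>
          obtain rfl : n = r + 1 := by omega
          rw [val (r + 1) (by omega) r 1 (by omega), Nat.add_sub_cancel,
            val r (by omega) r 0 (by omega)]
          simp [qFac, hermiteMoment]
          ring
        | 1, h + 1, hr =>
          obtain rfl : n = h + 1 := by omega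
          rw [zero _ (by omega) _ (by omega), prev _ (by omega), Nat.add_sub_cancel,
            val (h + 1) (by omega) 1 h (by omega)]
          simp [hermiteMoment]
        | r + 2, h + 1, hr =>
          obtain rfl : n = r + 1 + (h + 1) := by omega
          rw [val _ (by omega) r (h + 2) (by omega), Nat.add_sub_cancel,
            val (r + 1 + (h + 1)) (by omega) (r + 2) h (by omega),
            show r + 1 + (h + 1) - 1 = r + (h + 1) by omega,
            val _ (by omega) r (h + 1) rfl]
          have a1 := qFac_succ q 0 h
          have a2 := qFac_succ q 0 (h + 1)
          have b1 : qFac q r (h + 2) =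
              (1 - q ^ (r + 1)) * (1 - q ^ (r + 2)) * qFac q (r + 2) h := by
            rw [qFac_succ_left, qFac_succ_left]; ring
          have b2 := qFac_succ q r (h + 1)
          have b3 := qFac_succ q (r + 2) h
          rw [a2, b1, a1, b3]
          rw [b1] at b2
          simp only [zero_add, hermiteMoment] at *
          linear_combination (- qFac q 0 h * (1 - q ^ (h + 1)) * hermiteMoment q r) * (-b2)

theorem moment_qHermite (q : K) (n : ℕ) : moment q (qHermite q n) = hermiteMoment q n := by
  simpa [orthoPoly, qFac] using (moment_qHermite_mul_orthoPoly q n).2 n 0 rfl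

/-! ### Moments of the Chebyshev polynomials -/

/-- The value of `moment q` on `Sᵢ₋₁ Hₙ`, with the Chebyshev polynomial `Sᵢ₋₁`. The index is
shifted so that `i = 0` gives `S₋₁ = 0`. -/
noncomputable def mixedMoment (q : K) (n i : ℕ) : K :=
  moment q (Chebyshev.S K ((i : ℤ) - 1) * qHermite q n)

theorem mixedMoment_zero (q : K) (n : ℕ) : mixedMoment q n 0 = 0 := by
  simp [mixedMoment]

theorem mixedMoment_one (q : K) (n : ℕ) : mixedMoment q n 1 = hermiteMoment q n := by
  simp [mixedMoment, moment_qHermite]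

/-- The recurrence obtained by computing `X Sᵢ Hₙ` in two ways. -/
theorem mixedMoment_add_two (q : K) (n i : ℕ) : mixedMoment q n (i + 2) =
    mixedMoment q (n + 1) (i + 1) + (1 - q ^ n) * mixedMoment q (n - 1) (i + 1) -
      mixedMoment q n i := by
  simp only [mixedMoment]
  rw [← moment_C_mul, ← map_add, ← map_sub]
  congr 1
  have h := Chebyshev.S_add_two K ((i : ℤ) - 1)
  push_cast
  rw [show (i : ℤ) + 2 - 1 = i - 1 + 2 by ring, show (i : ℤ) + 1 - 1 = i - 1 + 1 by ring, h]
  linear_combination Chebyshev.S K ((i : ℤ) - 1 + 1) * X_mul_qHermite q n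

/-- The sequence `1, 0, -q, 0, q², 0, …`. It carries the parity of the index in the residue term
of `mixedMoment_shift`. -/
def altPow (q : K) : ℕ → K
  | 0 => 1
  | 1 => 0
  | i + 2 => -q * altPow q i

theorem altPow_two_mul (q : K) (m : ℕ) : altPow q (2 * m) = (-q) ^ m := by
  induction m with
  | zero => simp [altPow]
  | succ m ih => rw [Nat.mul_succ, altPow, ih, pow_succ']

theorem mul_hermiteMoment_pred (q : K) (n : ℕ) :
    q * ((1 - q ^ n) * hermiteMoment q (n - 1)) = -hermiteMoment q (n + 1) := by
  cases n with
  | zero => simp [hermiteMoment]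
  | succ n => simp only [hermiteMoment, Nat.add_sub_cancel]; ring

/-- The functional equation under `z ↦ qz`. The last summand is the residue at `z² = -q`. -/
theorem mixedMoment_shift (q : K) (hq : q ≠ 0) (i : ℕ) : ∀ n : ℕ,
    q ^ (n + 1) * mixedMoment q n i =
      q ^ i * (mixedMoment q (n + 2) i - (1 + q) * mixedMoment q (n + 1) (i + 1) +
        q * mixedMoment q n (i + 2)) +
      2 * (altPow q i * hermiteMoment q (n + 1) - altPow q (i + 1) * hermiteMoment q n) := by
  induction i using Nat.strong_induction_on with
  | _ i ih =>
    intro n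
    match i, ih with
    | 0, _ =>
      have := mul_hermiteMoment_pred q n
      simp only [mixedMoment_add_two, mixedMoment_zero, zero_add, mixedMoment_one, altPow]
      linear_combination -this
    | 1, _ =>
      have h1 := mul_hermiteMoment_pred q (n + 1)
      simp only [mixedMoment_add_two q _ 1, mixedMoment_add_two q _ 0, mixedMoment_zero, zero_add,
        mixedMoment_one, altPow, Nat.add_sub_cancel, Nat.reduceAdd] at *
      cases n with
      | zero => simp [hermiteMoment]; ring
      | succ n =>
        have h2 := mul_hermiteMoment_pred q n
        simp only [Nat.add_sub_cancel]
        simp only [hermiteMoment] at *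
        linear_combination -q * (1 - q ^ (n + 1)) * h2
    | i + 2, ih =>
      have e := mixedMoment_add_two q
      have r1 := ih (i + 1) (by omega) (n + 1)
      have r0 := ih i (by omega) n
      -- The relation at `(n - 1, i + 1)`, multiplied by a factor that vanishes for `n = 0`.
      have rm : (1 - q ^ n) * (q ^ n * mixedMoment q (n - 1) (i + 1)) =
          (1 - q ^ n) * (q ^ (i + 1) * (mixedMoment q (n + 1) (i + 1) -
            (1 + q) * mixedMoment q n (i + 2) + q * mixedMoment q (n - 1) (i + 3)) +
          2 * (altPow q (i + 1) * hermiteMoment q n -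
            altPow q (i + 2) * hermiteMoment q (n - 1))) := by
        cases n with
        | zero => simp
        | succ m => exact congrArg _ (ih (i + 1) (by omega) m)
      apply mul_left_cancel₀ hq
      have e1 := e n i
      have e2 := e (n + 2) i
      have e3 := e (n + 1) (i + 1)
      have e4 := e n (i + 2)
      have hw := mul_hermiteMoment_pred q n
      simp only [altPow, hermiteMoment, Nat.add_sub_cancel, Nat.add_succ_sub_one,
        Nat.reduceAdd, add_assoc] at *
      -- The two sides satisfy the same recurrence, which determines `(n, i + 2)` from
      -- `(n + 1, i + 1)`, `(n - 1, i + 1)` and `(n, i)`.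
      linear_combination r1 + q ^ 2 * rm - q * r0 + q ^ (n + 2) * e1 - q ^ (i + 1) * (e2 -
        (q + q ^ 2) * e3 + q ^ 3 * e4) + 2 * q ^ 2 * altPow q i * hw

theorem moment_S_add_two (q : K) (hq : q ≠ 0) (m : ℕ) :
    moment q (Chebyshev.S K (2 * (m + 1 : ℕ))) =
      q ^ (2 * m + 2) * moment q (Chebyshev.S K (2 * m)) + 2 * (-q) ^ (m + 1) := by
  have y : ∀ m : ℕ, mixedMoment q 0 (2 * m + 1) = moment q (Chebyshev.S K (2 * m)) := by
    intro m
    simp [mixedMoment, qHermite]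
  have h := mixedMoment_shift q hq (2 * m + 3) 0
  have e1 := mixedMoment_add_two q 0 (2 * m + 1)
  have e3 := mixedMoment_add_two q 0 (2 * m + 3)
  have e5 := mixedMoment_add_two q 1 (2 * m + 2)
  rw [← y, ← y]
  have b : altPow q (2 * m + 3 + 1) = (-q) ^ (m + 2) := altPow_two_mul q (m + 2)
  rw [b] at h
  simp only [hermiteMoment, Nat.reduceAdd, add_assoc, pow_zero, sub_self, zero_mul, zero_add,
    add_zero, pow_one, Nat.sub_self, mul_zero, zero_sub, Nat.reduceMul, mul_add] at *
  apply mul_left_cancel₀ hq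
  linear_combination h + q ^ (2 * m + 3) * (q * e3 - e5 - e1)

theorem moment_S_two_mul (q : K) (hq : q ≠ 0) (m : ℕ) :
    moment q (Chebyshev.S K (2 * m)) =
      q ^ (m ^ 2 + m) * ∑ l ∈ Finset.Icc (-(m : ℤ)) m, (-1 : K) ^ l * q ^ (-l ^ 2) := by
  induction m with
  | zero =>
    have := moment_X_pow q 0
    simpa [pathSum] using this
  | succ m ih =>
    have hI : Finset.Icc (-((m + 1 : ℕ) : ℤ)) (m + 1 : ℕ) =
        insert (-((m : ℤ) + 1)) (insert ((m : ℤ) + 1) (Finset.Icc (-(m : ℤ)) m)) := by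
      ext l
      simp only [Finset.mem_Icc, Finset.mem_insert]
      omega
    rw [moment_S_add_two q hq, ih, hI, Finset.sum_insert (by simp; omega),
      Finset.sum_insert (by simp)]
    have hs : (-1 : K) ^ (-((m : ℤ) + 1)) = (-1) ^ (m + 1) := by
      rw [zpow_neg, ← Nat.cast_succ, zpow_natCast, ← inv_pow]; simp
    have hs' : (-1 : K) ^ ((m : ℤ) + 1) = (-1) ^ (m + 1) := by
      rw [← Nat.cast_succ, zpow_natCast]
    have hz : q ^ ((m + 1) ^ 2) * q ^ (-((m : ℤ) + 1) ^ 2) = 1 := by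
      rw [zpow_neg, ← Nat.cast_succ, ← Nat.cast_pow, zpow_natCast]
      exact mul_inv_cancel₀ (pow_ne_zero _ hq)
    rw [hs, hs', neg_sq, neg_pow q]
    linear_combination (-2 * (-1) ^ (m + 1) * q ^ (m + 1)) * hz

/-! ### Expansion of monomials in Chebyshev polynomials -/

/-- The binomial expansion of `(z + z⁻¹)ⁿ`, in which `zʲ` may be replaced by `Sⱼ` because
`X Sⱼ = Sⱼ₊₁ + Sⱼ₋₁` for all integers `j`. -/
theorem X_pow_eq_sum_S (n : ℕ) : (X : K[X]) ^ n =
    ∑ k ∈ Finset.range (n + 1), (n.choose k : K[X]) * Chebyshev.S K (n - 2 * k) := by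
  induction n with
  | zero => simp
  | succ n ih =>
    have hX : ∀ j : ℤ, X * Chebyshev.S K j = Chebyshev.S K (j + 1) + Chebyshev.S K (j - 1) := by
      intro j
      rw [Chebyshev.S_add_one]; ring
    rw [pow_succ', ih, Finset.mul_sum, Finset.sum_range_succ' _ (n + 1)]
    have h0 : ∀ k : ℕ, ((n + 1).choose (k + 1) : K[X]) *
        Chebyshev.S K ((n + 1 : ℕ) - 2 * (k + 1 : ℕ)) =
        (n.choose k : K[X]) * Chebyshev.S K (n - 2 * k - 1) +
        (n.choose (k + 1) : K[X]) * Chebyshev.S K (n - 2 * (k + 1 : ℕ) + 1) := by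
      intro k
      rw [Nat.choose_succ_succ]
      push_cast
      rw [show ((n : ℤ) + 1 - 2 * (k + 1)) = n - 2 * k - 1 by ring,
        show ((n : ℤ) - 2 * (k + 1) + 1) = n - 2 * k - 1 by ring]
      ring
    have h1 := Finset.sum_range_succ'
      (fun k : ℕ => (n.choose k : K[X]) * Chebyshev.S K (n - 2 * k + 1)) (n + 1)
    rw [Finset.sum_range_succ] at h1
    simp only [Nat.choose_succ_self, Nat.cast_zero, zero_mul, add_zero] at h1
    rw [Finset.sum_congr rfl fun k _ => h0 k, Finset.sum_add_distrib]
    have h2 : ∀ k : ℕ, X * ((n.choose k : K[X]) * Chebyshev.S K (n - 2 * k)) =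
        (n.choose k : K[X]) * Chebyshev.S K (n - 2 * k + 1) +
        (n.choose k : K[X]) * Chebyshev.S K (n - 2 * k - 1) := by
      intro k
      rw [mul_left_comm, hX]; ring
    rw [Finset.sum_congr rfl fun k _ => h2 k, Finset.sum_add_distrib, h1]
    simp
    ring

/-- The terms of negative index in `X_pow_eq_sum_S` are folded back by `S₋ⱼ₋₂ = -Sⱼ`. -/
theorem X_pow_two_mul_eq_sum_S (N : ℕ) : (X : K[X]) ^ (2 * N) =
    ∑ m ∈ Finset.range (N + 1),
      (((2 * N).choose (N + m) : K[X]) - (2 * N).choose (N + m + 1)) * Chebyshev.S K (2 * m) := by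
  rw [X_pow_eq_sum_S, show 2 * N + 1 = (N + 1) + N by ring, Finset.sum_range_add]
  simp only [sub_mul, Finset.sum_sub_distrib]
  rw [← Finset.sum_range_reflect, sub_eq_add_neg]
  congr 1
  · refine Finset.sum_congr rfl fun m hm => ?_
    have hm : m ≤ N := by simpa [Nat.lt_succ_iff] using hm
    rw [Nat.add_sub_cancel, Nat.choose_symm_of_eq_add (show 2 * N = N - m + (N + m) by omega)]
    congr 2
    push_cast [hm]
    ring
  · rw [Finset.sum_range_succ, Nat.choose_eq_zero_of_lt (show 2 * N < N + N + 1 by omega),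
      Nat.cast_zero, zero_mul, add_zero, ← Finset.sum_neg_distrib]
    refine Finset.sum_congr rfl fun m _ => ?_
    rw [← mul_neg, ← Chebyshev.S_neg_sub_two, show N + 1 + m = N + m + 1 by ring]
    congr 2
    push_cast
    ring

theorem ballot_eq [CharZero K] (N m : ℕ) :
    ((2 * N).choose (N + m) : K) - (2 * N).choose (N + m + 1) =
      (2 * (m : K) + 1) * ((2 * N).choose (N + m) : K) / ((N : K) + (m : K) + 1) := by
  have hne : (N : K) + m + 1 ≠ 0 := by exact_mod_cast (N + m).succ_ne_zero
  rw [eq_div_iff hne]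
  rcases le_or_gt m N with hm | hm
  · have h := congrArg (Nat.cast (R := K)) (Nat.choose_succ_right_eq (2 * N) (N + m))
    rw [show 2 * N - (N + m) = N - m by omega] at h
    push_cast [hm] at h
    linear_combination -h
  · rw [Nat.choose_eq_zero_of_lt (show 2 * N < N + m by omega),
      Nat.choose_eq_zero_of_lt (show 2 * N < N + m + 1 by omega)]
    simp

theorem pathSum_closed [CharZero K] (q : K) (hq0 : q ≠ 0) (hq1 : q ≠ 1) (N : ℕ) :
    pathSum q (2 * N) 0 =
      1 / (1 - q) ^ (2 * N) *
        ∑ m ∈ Finset.range (N + 1),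
          q ^ (m ^ 2 + m) *
              (∑ l ∈ Finset.Icc (-(m : ℤ)) (m : ℤ), (-1 : K) ^ l * q ^ (-l ^ 2)) *
              (2 * (m : K) + 1) * ((2 * N).choose (N + m) : K) /
            ((N : K) + (m : K) + 1) := by
  have hne : (1 - q) ^ (2 * N) ≠ 0 := pow_ne_zero _ (sub_ne_zero.mpr hq1.symm)
  rw [one_div, eq_inv_mul_iff_mul_eq₀ hne, ← moment_X_pow, X_pow_two_mul_eq_sum_S, map_sum]
  refine Finset.sum_congr rfl fun m _ => ?_
  rw [← moment_S_two_mul q hq0, mul_assoc, mul_div_assoc, ← ballot_eq, ← map_natCast C,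
    ← map_natCast C, ← map_sub, moment_C_mul, mul_comm]

end Moments

theorem corollary4 {K : Type*} [Field K] [CharZero K] (q : K) (hq0 : q ≠ 0) (hq1 : q ≠ 1)
    (N : ℕ) :
    PowerSeries.coeff (2 * N) (secantGF q) =
      1 / (1 - q) ^ (2 * N) *
        ∑ m ∈ Finset.range (N + 1),
          q ^ (m ^ 2 + m) *
              (∑ l ∈ Finset.Icc (-(m : ℤ)) (m : ℤ), (-1 : K) ^ l * q ^ (-l ^ 2)) *
              (2 * (m : K) + 1) * ((2 * N).choose (N + m) : K) /
            ((N : K) + (m : K) + 1) := by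
  rw [← pathSum_closed q hq0 hq1 N, secantGF, PowerSeries.coeff_mk, if_pos (even_two_mul N),
    Nat.mul_div_cancel_left N two_pos, sum_secantCount]
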